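/- Let $d\ge 1$, let $X\subset\mathbb{R}^d$ be compact, and let $b_0>0$, $\varepsilon_0>0$ be fixed. Consider the single kernel $$k_{b_0,\varepsilon_0}(\mathbf{w},\mathbf{x})=\frac{(\mathbf{w}^\top\mathbf{x}+b_0)^2}{\|\mathbf{x}-\mathbf{w}\|^2+\varepsilon_0},\qquad \mathbf{w},\mathbf{x}\in X,$$ where $\|\cdot\|$ is the Euclidean norm. Then every function in the reproducing kernel Hilbert space $\mathcal{H}_{b_0,\varepsilon_0}$ of real-valued functions on $X$ with reproducing kernel $k_{b_0,\varepsilon_0}$ is continuous, and $\mathcal{H}_{b_0,\varepsilon_0}$ is dense in $C(X)$ in the uniform norm. Hence $k_{b_0,\varepsilon_0}$ is a universal kernel on $X$, that is, a continuous positive semidefinite kernel whose reproducing kernel Hilbert space is dense in $C(X)$. -/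

import Mathlib

/-- The biased Yat kernel on `ℝ^d`:
`k_{b,ε}(w, x) = (⟨w, x⟩ + b)² / (‖x - w‖² + ε)`. -/
noncomputable def yatKernel {d : ℕ} (b ε : ℝ) (w x : EuclideanSpace ℝ (Fin d)) : ℝ :=
  (inner ℝ w x + b) ^ 2 / (‖x - w‖ ^ 2 + ε)

/-- A real-valued kernel `k`, seen as an operator-valued kernel with values in the
endomorphisms of `ℝ` (`k x y` acts by multiplication), the form that Mathlib's theory of
reproducing kernel Hilbert spaces uses. -/
noncomputable def operatorKernel {X : Type*} (k : X → X → ℝ) : Matrix X X (ℝ →L[ℝ] ℝ) :=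
  Matrix.of fun x y => k x y • ContinuousLinearMap.id ℝ ℝ

/-- A kernel `k` is positive semidefinite (symmetric with `∑ᵢⱼ cᵢ cⱼ k(xᵢ, xⱼ) ≥ 0` for all
finite families) iff the associated operator-valued kernel is. -/
theorem operatorKernel_posSemidef_iff {X : Type*} (k : X → X → ℝ) :
    (operatorKernel k).PosSemidef ↔ (Matrix.of k).PosSemidef := by
  have hid : star (ContinuousLinearMap.id ℝ ℝ) = ContinuousLinearMap.id ℝ ℝ :=
    star_one (ℝ →L[ℝ] ℝ)
  have hH : (operatorKernel k).IsHermitian ↔ (Matrix.of k).IsHermitian := by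
    rw [Matrix.IsHermitian.ext_iff, Matrix.IsHermitian.ext_iff]
    refine forall_congr' fun i => forall_congr' fun j => ?_
    rw [ContinuousLinearMap.ext_ring_iff]
    simp [operatorKernel, hid]
  refine ((RKHS.posSemidef_tfae (K := operatorKernel k)).out 0 2 rfl rfl).trans ?_
  rw [hH, Matrix.PosSemidef]
  refine and_congr_right fun hs => forall_congr' fun c => ?_
  have hk : ∀ i j, k i j = k j i := fun i j => by simpa using hs.apply j i
  refine iff_of_eq (congrArg (0 ≤ ·) ?_)
  simp only [operatorKernel, Matrix.of_apply, RCLike.re_to_real]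
  refine Finset.sum_congr rfl fun i _ => Finset.sum_congr rfl fun j _ => ?_
  simp [hk i j]
  ring

/-- A (real-valued) reproducing kernel Hilbert space `H` of functions on a compact space `X`
is dense in `C(X)` for the uniform norm: its elements are continuous functions, and they form
a dense subset of `C(X, ℝ)` with its sup norm. -/
def RKHSDenseInC {X : Type*} [TopologicalSpace X] [CompactSpace X]
    (H : Type*) [NormedAddCommGroup H] [InnerProductSpace ℝ H] [RKHS ℝ H X ℝ] : Prop :=
  (∀ f : H, Continuous (f : X → ℝ)) ∧
    Dense {g : C(X, ℝ) | ∃ f : H, (f : X → ℝ) = g}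

/-- A kernel on a compact space `X` is universal: it is continuous and positive semidefinite,
and the reproducing kernel Hilbert space that it generates is dense in `C(X)`. -/
def IsUniversalKernel {X : Type*} [TopologicalSpace X] [CompactSpace X]
    (k : X → X → ℝ) : Prop :=
  Continuous (fun p : X × X => k p.1 p.2) ∧
    ∃ h : (Matrix.of k).PosSemidef,
      haveI : Fact (operatorKernel k).PosSemidef := ⟨(operatorKernel_posSemidef_iff k).2 h⟩
      RKHSDenseInC (X := X) (RKHS.OfKernel (operatorKernel k))

/-! Put `a(x) = ‖x‖² + ε/2 + 1`. A map `v` of `X` into the open unit ball satisfies `1 - ⟨v(w),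
v(x)⟩ = 2(‖x - w‖² + ε) / (a(w) a(x))` (`sum_yatBall`), so the kernel is `⟨ψ(w), ψ(x)⟩ / (1 - ⟨v(w),
v(x)⟩)`, where `ψ` is `√2/a` times the products of two coordinates of `(√b, x)`. Expanding the
geometric series gives a sum of feature products, hence positive semidefiniteness.

For density, let `L` annihilate all kernel sections. By compactness the expansion converges
uniformly, so applying `L` in each variable gives `∑ L(φ)² = 0`, and `L` kills every feature `φ`.
Among these are all monomials in `v` times the nowhere vanishing `√2 b / a`. As `v` is injective,
Stone–Weierstrass gives `L = 0`, and Hahn–Banach concludes. -/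

/-- A series of continuous functions with summable uniform bounds that converges pointwise to a
continuous function converges to it in the uniform norm. -/
theorem ContinuousMap.hasSum_of_hasSum_apply {X : Type*} [TopologicalSpace X] [CompactSpace X]
    {f : ℕ → C(X, ℝ)} {g : C(X, ℝ)} {B : ℕ → ℝ} (hB : Summable B) (hB0 : ∀ n, 0 ≤ B n)
    (hf : ∀ n x, |f n x| ≤ B n) (hfg : ∀ x, HasSum (fun n => f n x) (g x)) : HasSum f g := by
  have hs : Summable f := Summable.of_norm_bounded hB fun n =>
    (ContinuousMap.norm_le _ (hB0 n)).2 fun x => hf n x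
  have hg : ∑' n, f n = g := by
    ext x
    exact (ContinuousMap.hasSum_apply hs.hasSum x).unique (hfg x)
  exact hg ▸ hs.hasSum

/-- A kernel that is a pointwise convergent sum of squares `∑ φ(w) φ(x)` is positive
semidefinite. -/
theorem Matrix.posSemidef_of_hasSum_features {X : Type*} {J : ℕ → Type*} [∀ n, Fintype (J n)]
    {φ : ∀ n, J n → X → ℝ} {k : X → X → ℝ}
    (hk : ∀ w x, HasSum (fun n => ∑ j, φ n j w * φ n j x) (k w x)) :
    (Matrix.of k).PosSemidef := by
  refine ⟨Matrix.IsHermitian.ext fun i j => ?_, fun c => ?_⟩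
  · refine (hk j i).unique ?_
    simpa only [mul_comm, Matrix.of_apply, star_trivial] using hk i j
  · have h : HasSum (fun n => ∑ i ∈ c.support, ∑ j ∈ c.support,
        c i * (∑ a, φ n a i * φ n a j) * c j)
        (∑ i ∈ c.support, ∑ j ∈ c.support, c i * k i j * c j) :=
      hasSum_sum fun i _ => hasSum_sum fun j _ => ((hk i j).mul_left _).mul_right _
    refine h.nonneg fun n => ?_
    have : ∑ i ∈ c.support, ∑ j ∈ c.support, c i * (∑ a, φ n a i * φ n a j) * c j
        = ∑ a, (∑ i ∈ c.support, c i * φ n a i) ^ 2 := by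
      simp_rw [sq, Finset.sum_mul_sum]
      symm
      rw [Finset.sum_comm]
      refine Finset.sum_congr rfl fun i _ => ?_
      rw [Finset.sum_comm]
      refine Finset.sum_congr rfl fun j _ => ?_
      rw [Finset.mul_sum, Finset.sum_mul]
      exact Finset.sum_congr rfl fun a _ => by ring
    rw [this]
    exact Finset.sum_nonneg fun a _ => sq_nonneg _

/-- A continuous functional that annihilates all the sections of a uniformly convergent sum
`∑ φ(w) φ(x)` annihilates all the features `φ`. -/
theorem ContinuousMap.map_feature_eq_zero {X : Type*} [TopologicalSpace X] [CompactSpace X]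
    {J : ℕ → Type*} [∀ n, Fintype (J n)] {φ : ∀ n, J n → C(X, ℝ)} {K : X → C(X, ℝ)}
    {B : ℕ → ℝ} (hB : Summable B) (hB0 : ∀ n, 0 ≤ B n)
    (hφ : ∀ n w x, |∑ j, φ n j w * φ n j x| ≤ B n)
    (hK : ∀ w x, HasSum (fun n => ∑ j, φ n j w * φ n j x) (K w x))
    (L : C(X, ℝ) →L[ℝ] ℝ) (hL : ∀ w, L (K w) = 0) (n : ℕ) (j : J n) : L (φ n j) = 0 := by
  have h1 : ∀ w, HasSum (fun n => ∑ j, φ n j w • φ n j) (K w) := fun w =>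
    hasSum_of_hasSum_apply hB hB0 (fun n x => by simpa using hφ n w x)
      (fun x => by simpa using hK w x)
  -- Applying `L` in `x` leaves a uniformly convergent series in `w` for `w ↦ L (K w) = 0`. A second
  -- application of `L` produces squares.
  have h2 : HasSum (fun n => ∑ j, L (φ n j) • φ n j) 0 := by
    refine hasSum_of_hasSum_apply (hB.mul_left ‖L‖)
      (fun n => mul_nonneg (norm_nonneg L) (hB0 n)) (fun n w => ?_) (fun w => ?_)
    · have := L.le_of_opNorm_le_of_le le_rfl ((norm_le (∑ j, φ n j w • φ n j) (hB0 n)).2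
        fun x => by simpa using hφ n w x)
      simpa [mul_comm] using this
    · simpa [hL, mul_comm] using (h1 w).mapL L
  have h3 : HasSum (fun n => ∑ j, L (φ n j) ^ 2) 0 := by
    simpa [sq] using h2.mapL L
  have h4 := (hasSum_zero_iff_of_nonneg fun n => Finset.sum_nonneg fun j _ => sq_nonneg _).1 h3
  have h5 := (Finset.sum_eq_zero_iff_of_nonneg fun j _ => sq_nonneg _).1 (congrFun h4 n) j
    (Finset.mem_univ j)
  exact pow_eq_zero_iff two_ne_zero |>.1 h5

/-! ### Density by duality and Stone–Weierstrass -/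

/-- A subspace of a normed space that is annihilated by no nonzero functional is dense. -/
theorem Submodule.dense_of_forall_dual_eq_zero {E : Type*} [NormedAddCommGroup E]
    [NormedSpace ℝ E] (p : Submodule ℝ E)
    (h : ∀ L : E →L[ℝ] ℝ, (∀ x ∈ p, L x = 0) → L = 0) : Dense (p : Set E) := by
  intro x
  by_contra hx
  obtain ⟨L, u, hLu, hux⟩ := geometric_hahn_banach_closed_point
    (p.topologicalClosure.convex) p.isClosed_topologicalClosure hx
  have h0 : ∀ y ∈ p, L y = 0 := by
    intro y hy
    by_contra hne
    -- The multiple of `y` on which `L` equals `u` contradicts `L < u` on the subspace.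
    have := hLu _ (p.le_topologicalClosure (p.smul_mem (u / L y) hy))
    simp [hne] at this
  have hu := hLu 0 (zero_mem _)
  simp only [h L h0, zero_apply] at hu hux
  exact hu.not_gt hux

/-- If finitely many continuous functions separate points, and a functional annihilates all their
monomials times a fixed nowhere vanishing function, then it is zero. -/
theorem ContinuousMap.eq_zero_of_map_mul_prod_eq_zero {X ι : Type*} [TopologicalSpace X]
    [CompactSpace X] (v : ι → C(X, ℝ)) (hv : ∀ x y, (∀ i, v i x = v i y) → x = y)
    (g : C(X, ℝ)) (hg : ∀ x, g x ≠ 0) (L : C(X, ℝ) →L[ℝ] ℝ)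
    (hL : ∀ (n : ℕ) (α : Fin n → ι), L (g * ∏ j, v (α j)) = 0) : L = 0 := by
  have hmem : ∀ f ∈ Algebra.adjoin ℝ (Set.range v), L (g * f) = 0 := by
    intro f hf
    rw [← Subalgebra.mem_toSubmodule, Algebra.adjoin_eq_span] at hf
    induction hf using Submodule.span_induction with
    | mem f hf =>
      obtain ⟨l, hl, rfl⟩ := Submonoid.exists_list_of_mem_closure hf
      choose a ha using hl
      have := hL l.length fun j => a l[j] (List.getElem_mem _)
      rw [← List.prod_ofFn] at this
      convert this using 4
      refine List.ext_getElem (by simp) fun i h₁ h₂ => ?_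
      simp [ha]
    | zero => simp
    | add f₁ f₂ _ _ h₁ h₂ => simp [mul_add, h₁, h₂]
    | smul c f _ h => simp [h]
  have hdense : (Algebra.adjoin ℝ (Set.range v)).topologicalClosure = ⊤ := by
    refine subalgebra_topologicalClosure_eq_top_of_separatesPoints _ fun x y hxy => ?_
    obtain ⟨i, hi⟩ := not_forall.1 (mt (hv x y) hxy)
    exact ⟨v i, ⟨v i, Algebra.subset_adjoin ⟨i, rfl⟩, rfl⟩, hi⟩
  have hall : ∀ f, L (g * f) = 0 := by
    intro f
    have hf : f ∈ closure (Algebra.adjoin ℝ (Set.range v) : Set C(X, ℝ)) := by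
      rw [← Subalgebra.topologicalClosure_coe, hdense]; trivial
    have hc : IsClosed {f : C(X, ℝ) | L (g * f) = 0} :=
      isClosed_eq (by fun_prop) continuous_const
    exact closure_minimal hmem hc hf
  -- Every `f` is `g * (f / g)`, since `g` has no zeros.
  ext f
  have := hall ⟨fun x => f x / g x, f.continuous.div g.continuous hg⟩
  change L f = 0
  rw [← this]
  congr 1
  ext x
  simp [mul_div_cancel₀, hg x]

/-- For continuous functions `v` into the open unit ball of `ℝ^ι`, the sums of `v` products on a
compact space are uniformly bounded away from `1`. -/
theorem ContinuousMap.exists_abs_sum_mul_le {X ι : Type*} [TopologicalSpace X] [CompactSpace X]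
    [Fintype ι] (v : ι → C(X, ℝ)) (hv : ∀ x, ∑ i, v i x ^ 2 < 1) :
    ∃ r : ℝ, 0 ≤ r ∧ r < 1 ∧ ∀ w x, |∑ i, v i w * v i x| ≤ r := by
  obtain hX | hX := isEmpty_or_nonempty X
  · exact ⟨0, le_rfl, zero_lt_one, fun w => hX.elim w⟩
  · obtain ⟨z, -, hz⟩ := isCompact_univ.exists_isMaxOn Set.univ_nonempty
      (f := fun x => ∑ i, v i x ^ 2) (Continuous.continuousOn (by fun_prop))
    refine ⟨∑ i, v i z ^ 2, Finset.sum_nonneg fun i _ => sq_nonneg _, hv z, fun w x => ?_⟩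
    have hw : ∑ i, v i w ^ 2 ≤ ∑ i, v i z ^ 2 := hz (Set.mem_univ w)
    have hx : ∑ i, v i x ^ 2 ≤ ∑ i, v i z ^ 2 := hz (Set.mem_univ x)
    calc |∑ i, v i w * v i x| ≤ ∑ i, |v i w * v i x| := Finset.abs_sum_le_sum_abs _ _
      _ ≤ ∑ i, (v i w ^ 2 + v i x ^ 2) / 2 := Finset.sum_le_sum fun i _ => by
          rw [abs_le]
          constructor <;> nlinarith [sq_nonneg (v i w + v i x), sq_nonneg (v i w - v i x)]
      _ = (∑ i, v i w ^ 2 + ∑ i, v i x ^ 2) / 2 := by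
          rw [← Finset.sum_div, Finset.sum_add_distrib]
      _ ≤ _ := by linarith

/-! ### Szegő-type kernels -/

/-- The features of the kernel `⟨ψ(w), ψ(x)⟩ / (1 - ⟨v(w), v(x)⟩)`. -/
def szegoFeature {X ι κ : Type*} [TopologicalSpace X] (ψ : κ → C(X, ℝ)) (v : ι → C(X, ℝ))
    (n : ℕ) (j : κ × (Fin n → ι)) : C(X, ℝ) :=
  ψ j.1 * ∏ i, v (j.2 i)

/-- Indexing by words `Fin n → ι` rather than multi-indices avoids multinomial coefficients. -/
theorem sum_szegoFeature {X ι κ : Type*} [TopologicalSpace X] [Fintype ι] [Fintype κ]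
    (ψ : κ → C(X, ℝ)) (v : ι → C(X, ℝ)) (n : ℕ) (w x : X) :
    ∑ j, szegoFeature ψ v n j w * szegoFeature ψ v n j x
      = (∑ c, ψ c w * ψ c x) * (∑ i, v i w * v i x) ^ n := by
  rw [Fintype.sum_pow, Finset.sum_mul_sum, Fintype.sum_prod_type]
  refine Finset.sum_congr rfl fun c _ => Finset.sum_congr rfl fun α _ => ?_
  simp only [szegoFeature, ContinuousMap.mul_apply, ContinuousMap.prod_apply,
    Finset.prod_mul_distrib]
  ring

/-- The kernel `⟨ψ(w), ψ(x)⟩ / (1 - ⟨v(w), v(x)⟩)`, with `v` valued in the open unit ball, is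
the sum of the products of its features. -/
theorem hasSum_szegoFeature {X ι κ : Type*} [TopologicalSpace X] [CompactSpace X]
    [Fintype ι] [Fintype κ] (ψ : κ → C(X, ℝ)) (v : ι → C(X, ℝ))
    (hv : ∀ x, ∑ i, v i x ^ 2 < 1) (w x : X) :
    HasSum (fun n => ∑ j, szegoFeature ψ v n j w * szegoFeature ψ v n j x)
      ((∑ c, ψ c w * ψ c x) * (1 - ∑ i, v i w * v i x)⁻¹) := by
  obtain ⟨r, -, hr1, hr⟩ := ContinuousMap.exists_abs_sum_mul_le v hv
  simp only [sum_szegoFeature]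
  exact (hasSum_geometric_of_abs_lt_one ((hr w x).trans_lt hr1)).mul_left _

/-- If `v` is injective into the open unit ball and some `ψ c` vanishes nowhere, no nonzero
functional annihilates the sections of the kernel `⟨ψ(w), ψ(x)⟩ / (1 - ⟨v(w), v(x)⟩)`. -/
theorem ContinuousMap.eq_zero_of_map_szego_eq_zero {X ι κ : Type*} [TopologicalSpace X]
    [CompactSpace X] [Fintype ι] [Fintype κ] (ψ : κ → C(X, ℝ)) (v : ι → C(X, ℝ))
    (hv : ∀ x, ∑ i, v i x ^ 2 < 1) (hinj : ∀ x y, (∀ i, v i x = v i y) → x = y)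
    (c : κ) (hc : ∀ x, ψ c x ≠ 0) (K : X → C(X, ℝ))
    (hK : ∀ w x, K w x = (∑ c, ψ c w * ψ c x) * (1 - ∑ i, v i w * v i x)⁻¹)
    (L : C(X, ℝ) →L[ℝ] ℝ) (hL : ∀ w, L (K w) = 0) : L = 0 := by
  obtain ⟨r, hr0, hr1, hr⟩ := exists_abs_sum_mul_le v hv
  refine eq_zero_of_map_mul_prod_eq_zero v hinj (ψ c) hc L fun n α => ?_
  refine map_feature_eq_zero (φ := szegoFeature ψ v) (K := K)
    (B := fun n => (∑ c, ‖ψ c‖ * ‖ψ c‖) * r ^ n)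
    ((summable_geometric_of_lt_one hr0 hr1).mul_left _) (fun n => by positivity)
    (fun n w x => ?_) (fun w x => ?_) L hL n (c, α)
  · rw [sum_szegoFeature, abs_mul, abs_pow]
    gcongr
    · refine (Finset.abs_sum_le_sum_abs _ _).trans (Finset.sum_le_sum fun c _ => ?_)
      rw [abs_mul]
      exact mul_le_mul (norm_coe_le_norm (ψ c) w) (norm_coe_le_norm (ψ c) x) (abs_nonneg _)
        (norm_nonneg _)
    · exact hr w x
  · rw [hK]
    exact hasSum_szegoFeature ψ v hv w x

/-! ### Hilbert spaces with a continuous kernel -/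

/-- The elements of a reproducing kernel Hilbert space with a continuous real kernel are
continuous. -/
theorem RKHS.continuous_of_continuous_kernel {X H : Type*} [TopologicalSpace X]
    [NormedAddCommGroup H] [InnerProductSpace ℝ H] [CompleteSpace H] [RKHS ℝ H X ℝ]
    {k : X → X → ℝ} (hk : Continuous fun p : X × X => k p.1 p.2)
    (hH : RKHS.kernel H = operatorKernel k) (f : H) : Continuous (f : X → ℝ) := by
  have hinner : ∀ x y, inner ℝ (kerFun H x 1) (kerFun H y 1) = k x y := fun x y => by
    rw [kerFun_inner, kerFun_apply, hH]
    simp [operatorKernel]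
  have hcont : Continuous fun x => kerFun H x (1 : ℝ) := by
    refine continuous_iff_continuousAt.2 fun x => tendsto_iff_norm_sub_tendsto_zero.2 ?_
    have hsq : ∀ y, ‖kerFun H y (1 : ℝ) - kerFun H x 1‖ = √(k y y - 2 * k y x + k x x) := by
      intro y
      rw [← hinner y y, ← hinner y x, ← hinner x x, real_inner_self_eq_norm_sq,
        real_inner_self_eq_norm_sq, ← norm_sub_sq_real, Real.sqrt_sq (norm_nonneg _)]
    simp only [hsq]
    have h1 : Continuous fun y => k y y := hk.comp (by fun_prop : Continuous fun y => (y, y))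
    have h2 : Continuous fun y => k y x := hk.comp (by fun_prop : Continuous fun y => (y, x))
    have h3 : Continuous fun y => √(k y y - 2 * k y x + k x x) := by fun_prop
    convert h3.tendsto x using 2
    rw [← Real.sqrt_zero]
    congr 1
    ring
  have hf : (f : X → ℝ) = fun x => inner ℝ (kerFun H x 1) f := by
    ext x
    simp
  rw [hf]
  fun_prop

/-- A reproducing kernel Hilbert space with a continuous kernel on a compact space, no section of
which is annihilated by a nonzero functional on `C(X)`, is dense in `C(X)`. -/
theorem RKHSDenseInC.of_forall_dual_eq_zero {X H : Type*} [TopologicalSpace X] [CompactSpace X]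
    [NormedAddCommGroup H] [InnerProductSpace ℝ H] [CompleteSpace H] [RKHS ℝ H X ℝ]
    {k : X → X → ℝ} (hk : Continuous fun p : X × X => k p.1 p.2)
    (hH : RKHS.kernel H = operatorKernel k) (K : X → C(X, ℝ)) (hK : ∀ w x, K w x = k x w)
    (h : ∀ L : C(X, ℝ) →L[ℝ] ℝ, (∀ w, L (K w) = 0) → L = 0) : RKHSDenseInC (X := X) H := by
  refine ⟨RKHS.continuous_of_continuous_kernel hk hH, ?_⟩
  let p : Submodule ℝ C(X, ℝ) :=
    { carrier := {g | ∃ f : H, (f : X → ℝ) = g}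
      add_mem' := by
        rintro _ _ ⟨f₁, h₁⟩ ⟨f₂, h₂⟩
        exact ⟨f₁ + f₂, by simp [h₁, h₂]⟩
      zero_mem' := ⟨0, by simp⟩
      smul_mem' := by
        rintro c _ ⟨f, hf⟩
        exact ⟨c • f, by simp [hf]⟩ }
  refine p.dense_of_forall_dual_eq_zero fun L hL => h L fun w => hL _ ⟨RKHS.kerFun H w 1, ?_⟩
  ext x
  rw [RKHS.kerFun_apply, hH, hK]
  simp [operatorKernel]

/-! ### The Yat kernel in Szegő form -/

/-- The map from `X ⊂ ℝ^d` to the open unit ball of `ℝ^(d+1)` that turns the inverse multiquadric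
kernel into a Szegő kernel: with `a = ‖x‖² + ε/2`, its coordinates are `(a - 1)/(a + 1)` and
`2xᵢ/(a + 1)`. -/
noncomputable def yatBall {d : ℕ} (X : Set (EuclideanSpace ℝ (Fin d))) {ε : ℝ} (hε : 0 < ε) :
    Option (Fin d) → C(X, ℝ)
  | none => ⟨fun x => (‖x.1‖ ^ 2 + ε / 2 - 1) / (‖x.1‖ ^ 2 + ε / 2 + 1),
      Continuous.div (by fun_prop) (by fun_prop) fun x => by positivity⟩
  | some i => ⟨fun x => 2 / (‖x.1‖ ^ 2 + ε / 2 + 1) * x.1 i,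
      (Continuous.div (by fun_prop) (by fun_prop) fun x => by positivity).mul (by fun_prop)⟩

/-- The coordinates of `(√b, x)`, whose inner products are `⟨w, x⟩ + b`. -/
noncomputable def yatBias {d : ℕ} (X : Set (EuclideanSpace ℝ (Fin d))) (b : ℝ) :
    Option (Fin d) → C(X, ℝ)
  | none => ⟨fun _ => √b, by fun_prop⟩
  | some i => ⟨fun x => x.1 i, by fun_prop⟩

/-- The numerator features of the kernel: normalized products of two coordinates of `(√b, x)`. -/
noncomputable def yatNumerator {d : ℕ} (X : Set (EuclideanSpace ℝ (Fin d))) (b : ℝ) {ε : ℝ}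
    (hε : 0 < ε) (c : Option (Fin d) × Option (Fin d)) : C(X, ℝ) :=
  ⟨fun x => √2 / (‖x.1‖ ^ 2 + ε / 2 + 1),
    Continuous.div (by fun_prop) (by fun_prop) fun x => by positivity⟩ *
    (yatBias X b c.1 * yatBias X b c.2)

theorem EuclideanSpace.real_inner_eq_sum {d : ℕ} (w x : EuclideanSpace ℝ (Fin d)) :
    inner ℝ w x = ∑ i, w i * x i := by
  simp [PiLp.inner_apply, mul_comm]

/-- With `s`, `t` the values of `‖·‖² + ε/2` at `w`, `x`, one has `(s+1)(t+1) - (s-1)(t-1) =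
2(s+t)`, and `s + t - 2⟨w, x⟩ = ‖x - w‖² + ε`: each point carries half of `ε`. -/
theorem sum_yatBall {d : ℕ} (X : Set (EuclideanSpace ℝ (Fin d))) {ε : ℝ} (hε : 0 < ε) (w x : X) :
    1 - ∑ i, yatBall X hε i w * yatBall X hε i x
      = 2 / ((‖w.1‖ ^ 2 + ε / 2 + 1) * (‖x.1‖ ^ 2 + ε / 2 + 1)) * (‖x.1 - w.1‖ ^ 2 + ε) := by
  have hw : ‖w.1‖ ^ 2 + ε / 2 + 1 ≠ 0 := by positivity
  have hx : ‖x.1‖ ^ 2 + ε / 2 + 1 ≠ 0 := by positivity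
  have hs : ∑ i, yatBall X hε (some i) w * yatBall X hε (some i) x
      = 2 / (‖w.1‖ ^ 2 + ε / 2 + 1) * (2 / (‖x.1‖ ^ 2 + ε / 2 + 1)) * inner ℝ w.1 x.1 := by
    rw [EuclideanSpace.real_inner_eq_sum, Finset.mul_sum]
    refine Finset.sum_congr rfl fun i _ => ?_
    simp only [yatBall, ContinuousMap.coe_mk]
    ring
  rw [Fintype.sum_option, hs, norm_sub_sq_real, real_inner_comm]
  simp only [yatBall, ContinuousMap.coe_mk]
  field_simp
  ring

theorem sum_sq_yatBall_lt_one {d : ℕ} (X : Set (EuclideanSpace ℝ (Fin d))) {ε : ℝ} (hε : 0 < ε)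
    (x : X) : ∑ i, yatBall X hε i x ^ 2 < 1 := by
  have h := sum_yatBall X hε x x
  have hpos : 0 < 2 / ((‖x.1‖ ^ 2 + ε / 2 + 1) * (‖x.1‖ ^ 2 + ε / 2 + 1))
      * (‖x.1 - x.1‖ ^ 2 + ε) := by positivity
  simp only [sq] at h hpos ⊢
  linarith

/-- The `none` coordinate determines `‖x‖²`, hence the common denominator of the others. -/
theorem yatBall_injective {d : ℕ} (X : Set (EuclideanSpace ℝ (Fin d))) {ε : ℝ} (hε : 0 < ε)
    (x y : X) (h : ∀ i, yatBall X hε i x = yatBall X hε i y) : x = y := by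
  have hx : ‖x.1‖ ^ 2 + ε / 2 + 1 ≠ 0 := by positivity
  have hy : ‖y.1‖ ^ 2 + ε / 2 + 1 ≠ 0 := by positivity
  have h0 := h none
  simp only [yatBall, ContinuousMap.coe_mk] at h0
  rw [div_eq_div_iff hx hy] at h0
  have hn : ‖x.1‖ ^ 2 = ‖y.1‖ ^ 2 := by linarith
  refine Subtype.ext (PiLp.ext fun i => ?_)
  have hi := h (some i)
  simp only [yatBall, ContinuousMap.coe_mk, hn] at hi
  exact mul_left_cancel₀ (div_ne_zero two_ne_zero hy) hi

theorem sum_yatNumerator {d : ℕ} (X : Set (EuclideanSpace ℝ (Fin d))) {b ε : ℝ} (hb : 0 < b)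
    (hε : 0 < ε) (w x : X) :
    ∑ c, yatNumerator X b hε c w * yatNumerator X b hε c x
      = 2 / ((‖w.1‖ ^ 2 + ε / 2 + 1) * (‖x.1‖ ^ 2 + ε / 2 + 1)) * (inner ℝ w.1 x.1 + b) ^ 2 := by
  have hp : inner ℝ w.1 x.1 + b = ∑ i, yatBias X b i w * yatBias X b i x := by
    rw [Fintype.sum_option, EuclideanSpace.real_inner_eq_sum]
    simp only [yatBias, ContinuousMap.coe_mk]
    rw [Real.mul_self_sqrt hb.le, add_comm]
  rw [hp, pow_two (∑ i, _), Finset.sum_mul_sum, Finset.mul_sum, Fintype.sum_prod_type]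
  refine Finset.sum_congr rfl fun i _ => ?_
  rw [Finset.mul_sum]
  refine Finset.sum_congr rfl fun j _ => ?_
  simp only [yatNumerator, ContinuousMap.mul_apply, ContinuousMap.coe_mk]
  have h2 : √(2 : ℝ) * √2 = 2 := Real.mul_self_sqrt zero_le_two
  rw [show ∀ p q r s t u : ℝ, √2 / p * (r * s) * (√2 / q * (t * u))
    = √2 * √2 / (p * q) * (r * t * (s * u)) from fun p q r s t u => by ring, h2]

/-- The factor `2 / (a(w) a(x))` occurs in both numerator and denominator and cancels. -/
theorem yatKernel_eq_szego {d : ℕ} (X : Set (EuclideanSpace ℝ (Fin d))) {b ε : ℝ} (hb : 0 < b)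
    (hε : 0 < ε) (w x : X) :
    yatKernel b ε w.1 x.1 = (∑ c, yatNumerator X b hε c w * yatNumerator X b hε c x) *
      (1 - ∑ i, yatBall X hε i w * yatBall X hε i x)⁻¹ := by
  have hw : ‖w.1‖ ^ 2 + ε / 2 + 1 ≠ 0 := by positivity
  have hx : ‖x.1‖ ^ 2 + ε / 2 + 1 ≠ 0 := by positivity
  have hd : ‖x.1 - w.1‖ ^ 2 + ε ≠ 0 := by positivity
  have hc : 2 / ((‖w.1‖ ^ 2 + ε / 2 + 1) * (‖x.1‖ ^ 2 + ε / 2 + 1)) ≠ 0 :=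
    div_ne_zero two_ne_zero (mul_ne_zero hw hx)
  rw [sum_yatBall, sum_yatNumerator X hb, ← div_eq_mul_inv, mul_div_mul_left _ _ hc, yatKernel]

theorem continuous_yatKernel {d : ℕ} (b : ℝ) {ε : ℝ} (hε : 0 < ε) :
    Continuous fun p : EuclideanSpace ℝ (Fin d) × EuclideanSpace ℝ (Fin d) =>
      yatKernel b ε p.1 p.2 :=
  Continuous.div (by fun_prop) (by fun_prop) fun p => by positivity

/-- The sum of squares representation makes the biased Yat kernel positive semidefinite. -/
theorem posSemidef_yatKernel {d : ℕ} (X : Set (EuclideanSpace ℝ (Fin d))) [CompactSpace X]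
    {b ε : ℝ} (hb : 0 < b) (hε : 0 < ε) :
    (Matrix.of fun w x : X => yatKernel b ε w.1 x.1).PosSemidef := by
  refine Matrix.posSemidef_of_hasSum_features
    (φ := fun n j => szegoFeature (yatNumerator X b hε) (yatBall X hε) n j) fun w x => ?_
  rw [yatKernel_eq_szego X hb hε]
  exact hasSum_szegoFeature _ _ (sum_sq_yatBall_lt_one X hε) w x

/-- Every reproducing kernel Hilbert space of the biased Yat kernel on a compact set `X` is dense
in `C(X)`. -/
theorem rkhsDenseInC_of_kernel_eq_yatKernel {d : ℕ} (X : Set (EuclideanSpace ℝ (Fin d)))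
    [CompactSpace X] {b ε : ℝ} (hb : 0 < b) (hε : 0 < ε) {H : Type*} [NormedAddCommGroup H]
    [InnerProductSpace ℝ H] [CompleteSpace H] [RKHS ℝ H X ℝ]
    (hH : RKHS.kernel H = operatorKernel (fun w x : X => yatKernel b ε w.1 x.1)) :
    RKHSDenseInC (X := X) H := by
  have hk : Continuous fun p : X × X => yatKernel b ε p.1.1 p.2.1 :=
    (continuous_yatKernel b hε).comp (f := fun p : X × X => (p.1.1, p.2.1)) (by fun_prop)
  let K : X → C(X, ℝ) := fun w =>
    ⟨fun x => yatKernel b ε x.1 w.1, hk.comp (f := fun x => (x, w)) (by fun_prop)⟩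
  refine RKHSDenseInC.of_forall_dual_eq_zero hk hH K (fun _ _ => rfl) fun L hL => ?_
  -- The feature `(none, none)` is `√2 b / a`, nonzero everywhere because `b > 0`.
  refine ContinuousMap.eq_zero_of_map_szego_eq_zero (yatNumerator X b hε) (yatBall X hε)
    (sum_sq_yatBall_lt_one X hε) (yatBall_injective X hε) (none, none) (fun x => ?_) K
    (fun w x => ?_) L hL
  · have h2 : √2 / (‖x.1‖ ^ 2 + ε / 2 + 1) * (√b * √b) ≠ 0 := by positivity
    exact h2
  · change yatKernel b ε x.1 w.1 = _
    rw [yatKernel_eq_szego X hb hε]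
    simp only [mul_comm]

theorem proposition3 {d : ℕ} (X : Set (EuclideanSpace ℝ (Fin d))) [CompactSpace X]
    (b₀ ε₀ : ℝ) (hb₀ : 0 < b₀) (hε₀ : 0 < ε₀) :
    (∀ (H : Type*) [NormedAddCommGroup H] [InnerProductSpace ℝ H] [CompleteSpace H]
        [RKHS ℝ H X ℝ],
        RKHS.kernel H = operatorKernel (fun w x : X => yatKernel b₀ ε₀ w.1 x.1) →
          RKHSDenseInC (X := X) H) ∧
      IsUniversalKernel (fun w x : X => yatKernel b₀ ε₀ w.1 x.1) := by

  have hpsd := posSemidef_yatKernel X hb₀ hε₀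
  refine ⟨fun H _ _ _ _ hH => rkhsDenseInC_of_kernel_eq_yatKernel X hb₀ hε₀ hH,
    (continuous_yatKernel b₀ hε₀).comp (f := fun p : X × X => (p.1.1, p.2.1)) (by fun_prop),
    hpsd, ?_⟩
  have : Fact (operatorKernel fun w x : X => yatKernel b₀ ε₀ w.1 x.1).PosSemidef :=
    ⟨(operatorKernel_posSemidef_iff _).2 hpsd⟩
  exact rkhsDenseInC_of_kernel_eq_yatKernel X hb₀ hε₀ RKHS.OfKernel.kernel_ofKernel
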